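/- A straight-line drawing of a graph $G$ represents its vertices by distinct points of the plane, no three on a line, and its edges by the segments joining them; it is convex if the points are in convex position. An edge-ordering of $G$ is a total order of its edges. All binary trees are rooted and complete (every non-leaf has two children and all leaves have the same depth); the size of a tree is its number of vertices. A binary tree contained in an edge-ordered drawing of $G$ is increasing (decreasing) if on every path from the root to a leaf the edges, read from the root, increase (decrease), and it is non-crossing if no two of its edges cross. Let $\overline\tau_+(G)$ (respectively $\overline\tau_-(G)$) be the minimum, over all straight-line drawings of $G$ and all edge-orderings, of the maximum size of a non-crossing increasing (respectively decreasing) binary tree. Theorem 5. $\overline\tau_+(K_n)=O(\log n)$ and $\overline\tau_-(K_n)=O(\log n)$. More precisely, there is a constant $C>0$ such that for every $n\ge 2$ there is a convex straight-line drawing of $K_n$ with the following property. For an edge $e$, let $s(e)$ be the number of vertices on the smaller side of the supporting line of $e$. There is an edge-ordering with $e<e'$ whenever $s(e)<s(e')$ in which every non-crossing increasing binary tree has size at most $C\log n$, and there is an edge-ordering with $e>e'$ whenever $s(e)<s(e')$ in which every non-crossing decreasing binary tree has size at most $C\log n$. -/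

import Mathlib

open Filter Asymptotics

/-- The Euclidean plane. -/
abbrev Plane : Type := EuclideanSpace ℝ (Fin 2)

/-- A straight-line drawing of a graph with (finite) vertex set `V`: the vertices are distinct points
of the plane in general position (no three on a line). The edge `uv` is drawn as the segment
joining the points of `u` and `v`. -/
structure StraightLineDrawing (V : Type) where
  point : V → Plane
  injective : Function.Injective point
  generalPosition : ∀ u v w : V, u ≠ v → u ≠ w → v ≠ w →
    ¬ Collinear ℝ {point u, point v, point w}

namespace StraightLineDrawing

variable {V : Type}

/-- The drawing is convex: its vertices are in convex position, i.e. each of them is outside the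
convex hull of the others. -/
def IsConvex (D : StraightLineDrawing V) : Prop := ConvexIndependent ℝ D.point

/-- A set of edges is non-crossing in the drawing: no two different edges have a common point in
their relative interiors. (Vertices being in general position, this is the only way in which two
edges can meet outside a common endpoint.) -/
def NonCrossing (D : StraightLineDrawing V) (E : Set (Sym2 V)) : Prop :=
  ∀ a b c d : V, s(a, b) ∈ E → s(c, d) ∈ E → s(a, b) ≠ s(c, d) →
    Disjoint (openSegment ℝ (D.point a) (D.point b)) (openSegment ℝ (D.point c) (D.point d))

/-- Twice the signed area of the triangle `uvw`: positive (negative) if `w` is strictly to the left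
(right) of the directed line from `u` to `v`. -/
def orient (D : StraightLineDrawing V) (u v w : V) : ℝ :=
  (D.point v 0 - D.point u 0) * (D.point w 1 - D.point u 1) -
    (D.point v 1 - D.point u 1) * (D.point w 0 - D.point u 0)

/-- The number of vertices on the smaller side of the supporting line of the edge `uv`. -/
noncomputable def smallerSide (D : StraightLineDrawing V) (u v : V) : ℕ :=
  min {w | 0 < D.orient u v w}.ncard {w | D.orient u v w < 0}.ncard

end StraightLineDrawing

/-- An edge-ordering of a graph: a total order of its edges. -/
abbrev EdgeOrdering {V : Type} (G : SimpleGraph V) : Type := LinearOrder G.edgeSet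

namespace EdgeOrdering

variable {V : Type} {G : SimpleGraph V}

/-- `e` and `f` are edges of `G`, and `e` is smaller than `f` in the edge-ordering. -/
def Less (o : EdgeOrdering G) (e f : Sym2 V) : Prop :=
  ∃ (he : e ∈ G.edgeSet) (hf : f ∈ G.edgeSet), o.lt ⟨e, he⟩ ⟨f, hf⟩

/-- The edges of the path `v 0, v 1, …, v k` increase along the path. -/
def IncreasingPath (o : EdgeOrdering G) (k : ℕ) (v : ℕ → V) : Prop :=
  ∀ i, i + 2 ≤ k → Less o s(v i, v (i + 1)) s(v (i + 1), v (i + 2))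

/-- The edges of the path `v 0, v 1, …, v k` decrease along the path. -/
def DecreasingPath (o : EdgeOrdering G) (k : ℕ) (v : ℕ → V) : Prop :=
  ∀ i, i + 2 ≤ k → Less o s(v (i + 1), v (i + 2)) s(v i, v (i + 1))

end EdgeOrdering

/-- A complete rooted binary tree of height `h` contained in the graph `G`. The nodes of the complete
binary tree are the words of length at most `h` over a two-letter alphabet; the root is the empty
word and the children of a word `l` of length less than `h` are `l ++ [false]` and `l ++ [true]`.
The values of `node` on longer words play no role. -/
structure EmbeddedBinaryTree {V : Type} (G : SimpleGraph V) (h : ℕ) where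
  node : List Bool → V
  injOn : Set.InjOn node {l | l.length ≤ h}
  adj : ∀ (l : List Bool) (b : Bool), l.length < h → G.Adj (node l) (node (l ++ [b]))

namespace EmbeddedBinaryTree

variable {V : Type} {G : SimpleGraph V} {h : ℕ}

/-- The vertices of the tree. -/
def verts (T : EmbeddedBinaryTree G h) : Set V := T.node '' {l | l.length ≤ h}

/-- The edges of the tree. -/
def edges (T : EmbeddedBinaryTree G h) : Set (Sym2 V) :=
  {e | ∃ (l : List Bool) (b : Bool), l.length < h ∧ e = s(T.node l, T.node (l ++ [b]))}

/-- The size of the tree: its number of vertices. -/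
noncomputable def size (T : EmbeddedBinaryTree G h) : ℕ := T.verts.ncard

/-- Every path from the root to a leaf is increasing. The leaves are the words `l` of length `h`,
and the `i`-th vertex of the path to `l` is the prefix of length `i` of `l`. -/
def Increasing (T : EmbeddedBinaryTree G h) (o : EdgeOrdering G) : Prop :=
  ∀ l : List Bool, l.length = h → EdgeOrdering.IncreasingPath o h (fun i => T.node (l.take i))

/-- Every path from the root to a leaf is decreasing. -/
def Decreasing (T : EmbeddedBinaryTree G h) (o : EdgeOrdering G) : Prop :=
  ∀ l : List Bool, l.length = h → EdgeOrdering.DecreasingPath o h (fun i => T.node (l.take i))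

end EmbeddedBinaryTree

section Parameters

variable {V : Type}

/-- The maximum size of a non-crossing increasing binary tree in a drawing of the finite graph `G`
with a given edge-ordering. -/
noncomputable def maxIncreasing (G : SimpleGraph V) (D : StraightLineDrawing V)
    (o : EdgeOrdering G) : ℕ :=
  sSup {m | ∃ (h : ℕ) (T : EmbeddedBinaryTree G h),
    D.NonCrossing T.edges ∧ T.Increasing o ∧ T.size = m}

/-- The maximum size of a non-crossing decreasing binary tree in a drawing of the finite graph `G`
with a given edge-ordering. -/
noncomputable def maxDecreasing (G : SimpleGraph V) (D : StraightLineDrawing V)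
    (o : EdgeOrdering G) : ℕ :=
  sSup {m | ∃ (h : ℕ) (T : EmbeddedBinaryTree G h),
    D.NonCrossing T.edges ∧ T.Decreasing o ∧ T.size = m}

/-- The parameter `τ̄₊` of a drawing of `G`: the minimum over all edge-orderings. -/
noncomputable def drawingTauPlus (G : SimpleGraph V) (D : StraightLineDrawing V) : ℕ :=
  ⨅ o : EdgeOrdering G, maxIncreasing G D o

/-- The parameter `τ̄₋` of a drawing of `G`: the minimum over all edge-orderings. -/
noncomputable def drawingTauMinus (G : SimpleGraph V) (D : StraightLineDrawing V) : ℕ :=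
  ⨅ o : EdgeOrdering G, maxDecreasing G D o

/-- The parameter `τ̄₊(G)`: the minimum over all straight-line drawings of `G`. -/
noncomputable def tauPlus (G : SimpleGraph V) : ℕ :=
  ⨅ D : StraightLineDrawing V, drawingTauPlus G D

/-- The parameter `τ̄₋(G)`: the minimum over all straight-line drawings of `G`. -/
noncomputable def tauMinus (G : SimpleGraph V) : ℕ :=
  ⨅ D : StraightLineDrawing V, drawingTauMinus G D

end Parameters

/-!
The vertices are placed on a parabola. An edge then crosses another one exactly when their ends
alternate in the cyclic order, and the number of vertices on its smaller side is its cyclic length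
minus one. Whatever way ties are broken, the edges of an increasing tree (for the ordering by smaller
sides) or of a decreasing tree (for the reversed ordering) weakly increase in cyclic length from the
root to the leaves, and nothing else about the orderings is used.

Cut the circle at the root. Suppose that a node `w` has a child `q` such that the subtree of `q` lies
in an arc of at most half of the circle starting at `w`. As lengths do not decrease, both children of
`q` are further out, say `x` and then `y`, and as no edges cross, the subtree of `x` lies between `q`
and `y`. If subtrees of height `k` reach out to `g k` times the length of the edge above them, then
the edge `qy` is at least `g k` times as long as `wq`, and the subtree of `y` gains the same factor
again. So `g (k + 1) = g k ^ 2 + 1` is possible (`IsLayout.growth_mul_le`), which is doubly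
exponential in `k`.

Such a pair `w`, `q` always exists within the first two levels (`IsLayout.growth_le`). Let `a < b` be
the children of the root. The first child of `a` or, going around in the other direction, the first
child of `b` serves, since otherwise the edges from `a` and `b` to their second children would both
be longer than half of the circle and cross. Hence a tree of height `h ≥ 3` exists only
if `2 ^ 2 ^ (h - 3) ≤ n`, while its size is less than `2 ^ (h + 1)`.
-/

/-! ### Layouts of binary trees on a cycle of integers -/

/-- The length of the shorter of the two arcs between `x` and `y` on a cycle of `n` points, for
`|x - y| ≤ n`. -/
def arcLength (n x y : ℤ) : ℤ := min |x - y| (n - |x - y|)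

/-- The endpoints of the pairs `{x, y}` and `{z, w}` alternate on the line, and the leftmost one
belongs to `{x, y}`. -/
def Crosses (x y z w : ℤ) : Prop :=
  min x y < min z w ∧ min z w < max x y ∧ max x y < max z w

/-- A placement `f` of the complete binary tree of height `h` on the integers `0, …, n - 1`, seen as
`n` points on a circle which is cut open at the root. No two edges cross, and the cyclic lengths of
the edges weakly increase from the root to the leaves. -/
structure IsLayout (n : ℤ) (h : ℕ) (f : List Bool → ℤ) : Prop where
  injOn : Set.InjOn f {l | l.length ≤ h}
  root : f [] = 0
  nonneg : ∀ l, l.length ≤ h → 0 ≤ f l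
  lt : ∀ l, l.length ≤ h → f l < n
  nonCrossing : ∀ l b l' b', l.length < h → l'.length < h →
    ¬ Crosses (f l) (f (l ++ [b])) (f l') (f (l' ++ [b']))
  arcLength_le : ∀ l b c, l.length + 1 < h →
    arcLength n (f l) (f (l ++ [b])) ≤ arcLength n (f (l ++ [b])) (f (l ++ [b] ++ [c]))

/-- The growth rate of layouts: `1, 2, 5, 26, …`. -/
def growth : ℕ → ℕ
  | 0 => 1
  | k + 1 => growth k ^ 2 + 1

theorem two_pow_two_pow_le_growth (k : ℕ) : 2 ^ 2 ^ k ≤ growth (k + 1) := by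
  induction k with
  | zero => simp [growth]
  | succ k ih =>
    calc 2 ^ 2 ^ (k + 1) = (2 ^ 2 ^ k) ^ 2 := by rw [← pow_mul, pow_succ]
      _ ≤ growth (k + 1) ^ 2 := Nat.pow_le_pow_left ih 2
      _ ≤ growth (k + 2) := Nat.le_succ _

namespace IsLayout

variable {n : ℤ} {h : ℕ} {f : List Bool → ℤ}

theorem ne (H : IsLayout n h f) {l l' : List Bool} (hl : l.length ≤ h) (hl' : l'.length ≤ h)
    (hne : l ≠ l') : f l ≠ f l' :=
  fun he => hne (H.injOn hl hl' he)

theorem pos (H : IsLayout n h f) {l : List Bool} (hl : l.length ≤ h) (hne : l ≠ []) :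
    0 < f l := by
  have h0 := H.ne hl (by simp) hne
  have h1 := H.nonneg l hl
  have h2 := H.root
  omega

theorem exists_lt_not (H : IsLayout n h f) (w : List Bool) (hw : w.length < h) :
    ∃ c : Bool, f (w ++ [c]) < f (w ++ [!c]) := by
  have h3 := H.ne (l := w ++ [false]) (l' := w ++ [true]) (by simpa) (by simpa) (by simp)
  rcases lt_or_gt_of_ne h3 with h3 | h3
  · exact ⟨false, h3⟩
  · exact ⟨true, h3⟩

/-- A subtree that avoids the two ends of an edge lies on one side of that edge: a path changing
sides would cross the edge. -/
theorem between_iff (H : IsLayout n h f) {w x : List Bool} {d : Bool} (hw : w.length < h)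
    (l : List Bool) (hl : (x ++ l).length ≤ h)
    (h1 : ∀ m, x ++ m ≠ w) (h2 : ∀ m, x ++ m ≠ w ++ [d]) :
    (min (f w) (f (w ++ [d])) < f (x ++ l) ∧ f (x ++ l) < max (f w) (f (w ++ [d]))) ↔
      (min (f w) (f (w ++ [d])) < f x ∧ f x < max (f w) (f (w ++ [d]))) := by
  induction l using List.reverseRecOn with
  | nil => simp
  | append_singleton l c ih =>
    have hlen : (x ++ l).length < h := by simp at hl ⊢; omega
    rw [← ih hlen.le, ← List.append_assoc]
    have hl' : (x ++ l ++ [c]).length ≤ h := by simpa using hl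
    have hwd : (w ++ [d]).length ≤ h := by simpa using hw
    have e1 := H.ne hlen.le hw.le (h1 l)
    have e2 := H.ne hlen.le hwd (h2 l)
    have e3 := H.ne hl' hw.le (by simpa using h1 (l ++ [c]))
    have e4 := H.ne hl' hwd (by rw [List.append_assoc]; exact h2 _)
    have c1 := H.nonCrossing (x ++ l) c w d hlen hw
    have c2 := H.nonCrossing w d (x ++ l) c hw hlen
    unfold Crosses at c1 c2
    omega

/-- If a node has its child on the right and the whole subtree of that child stays on the right,
within half of the circle, then the subtree reaches out to `growth k` times the length of the edge
to the child. Both grandchildren are again further to the right; the whole subtree of the nearer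
one fits below the edge to the farther one, so that this edge is `growth (k - 1)` times longer, and
the subtree of the farther one gains that factor again. -/
theorem growth_mul_le (H : IsLayout n h f) (k : ℕ) (w : List Bool) (b : Bool)
    (hk : w.length + 1 + k ≤ h)
    (hside : ∀ l, l.length ≤ k → f w < f (w ++ [b] ++ l) ∧ 2 * (f (w ++ [b] ++ l) - f w) ≤ n) :
    ∃ l, l.length ≤ k ∧ growth k * (f (w ++ [b]) - f w) ≤ f (w ++ [b] ++ l) - f w := by
  induction k generalizing w b with
  | zero => exact ⟨[], by simp, by simp [growth]⟩
  | succ k ih =>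
    have hwq := hside [] (by simp)
    simp only [List.append_nil] at hwq
    have hlen (c : Bool) : f (w ++ [b]) - f w ≤ f (w ++ [b] ++ [c]) - f (w ++ [b]) := by
      have h1 := hside [c] (by simp)
      have h2 := H.arcLength_le w b c (by omega)
      have h3 := H.ne (l := w ++ [b] ++ [c]) (l' := w ++ [b]) (by simp; omega) (by simp; omega)
        (by simp)
      unfold arcLength at h2
      simp only [abs_eq_max_neg] at h2
      omega
    obtain ⟨c, hc⟩ := H.exists_lt_not (w ++ [b]) (by simp; omega)
    have hnear (l : List Bool) (hl : l.length ≤ k) : f (w ++ [b]) < f (w ++ [b] ++ [c] ++ l) ∧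
        f (w ++ [b] ++ [c] ++ l) < f (w ++ [b] ++ [!c]) := by
      have := H.between_iff (w := w ++ [b]) (x := w ++ [b] ++ [c]) (d := !c) (by simp; omega) l
        (by simp; omega) (by simp) (by simp)
      have := hlen c
      omega
    have hfar (l : List Bool) (hl : l.length ≤ k) : f (w ++ [b]) < f (w ++ [b] ++ [!c] ++ l) := by
      have h1 := H.between_iff (w := w) (x := w ++ [b] ++ [!c]) (d := b) (by omega) l
        (by simp; omega) (by simp) (by simp)
      have h2 := (hside ([!c] ++ l) (by simp; omega)).1
      have h3 := H.ne (l := w ++ [b] ++ [!c] ++ l) (l' := w ++ [b]) (by simp; omega)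
        (by simp; omega) (by simp)
      rw [← List.append_assoc] at h2
      have := hlen (!c)
      omega
    obtain ⟨l₁, hl₁, h₁⟩ := ih (w ++ [b]) c (by simp; omega) fun l hl => by
      have := hside ([c] ++ l) (by simp; omega)
      rw [← List.append_assoc] at this
      have := hnear l hl
      omega
    obtain ⟨l₂, hl₂, h₂⟩ := ih (w ++ [b]) (!c) (by simp; omega) fun l hl => by
      have := hside ([!c] ++ l) (by simp; omega)
      rw [← List.append_assoc] at this
      have := hfar l hl
      omega
    refine ⟨[!c] ++ l₂, by simp; omega, ?_⟩
    rw [← List.append_assoc]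
    have h3 := (hnear l₁ hl₁).2
    have h4 := hlen c
    have hg : (0 : ℤ) ≤ growth k := by positivity
    have h5 : (growth k : ℤ) * (f (w ++ [b]) - f w) ≤ f (w ++ [b] ++ [!c]) - f (w ++ [b]) := by
      nlinarith
    have h6 := mul_le_mul_of_nonneg_left h5 hg
    simp only [growth]
    push_cast
    nlinarith

/-- The mirror image of a layout, with the root still at `0`. -/
theorem reflect (H : IsLayout n h f) : IsLayout n h fun l => if l = [] then 0 else n - f l where
  injOn := by
    intro l hl l' hl' he
    by_contra hne
    have h1 := H.ne hl hl' hne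
    have h2 := H.lt l hl
    have h3 := H.lt l' hl'
    dsimp only at he
    split_ifs at he
    · simp_all
    all_goals omega
  root := by simp
  nonneg l hl := by
    have := H.lt l hl
    split_ifs <;> omega
  lt l hl := by
    have h1 := H.lt l hl
    have h2 := H.nonneg l hl
    have h3 := fun hne => H.pos hl hne
    split_ifs with h
    · omega
    · have := h3 h
      omega
  nonCrossing := by
    intro l b l' b' hl hl'
    have c1 := H.nonCrossing l b l' b' hl hl'
    have c2 := H.nonCrossing l' b' l b hl' hl
    have p1 := H.pos (l := l ++ [b]) (by simpa using hl) (by simp)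
    have p2 := H.pos (l := l' ++ [b']) (by simpa using hl') (by simp)
    have q1 := H.lt (l ++ [b]) (by simpa using hl)
    have q2 := H.lt (l' ++ [b']) (by simpa using hl')
    have p3 := H.lt l hl.le
    have p4 := H.lt l' hl'.le
    unfold Crosses at *
    simp only [List.append_eq_nil_iff, List.cons_ne_self, and_false, if_false]
    split_ifs with h1 h2 h2
    · omega
    · subst h1
      rw [H.root] at c1 c2
      have := H.pos hl'.le h2
      omega
    · subst h2
      rw [H.root] at c1 c2
      have := H.pos hl.le h1
      omega
    · omega
  arcLength_le := by
    intro l b c hl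
    have h1 := H.arcLength_le l b c hl
    have p1 := H.pos (l := l ++ [b]) (by simp; omega) (by simp)
    have q1 := H.lt (l ++ [b]) (by simp; omega)
    unfold arcLength at *
    simp only [abs_eq_max_neg, List.append_eq_nil_iff, and_false, if_false, reduceCtorEq] at *
    split_ifs with h2
    · subst h2
      rw [H.root] at h1
      omega
    · omega

/-- If the child of the root that comes first is at most half of the circle away, then its own
children lie between the two children of the root. If moreover the farther one of them is at most
half of the circle away from it, then the subtree of the nearer one is large. -/
theorem exists_grandchildren {k : ℕ} (H : IsLayout n (k + 2) f) {c : Bool} (hc : f [c] < f [!c])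
    (hcn : 2 * f [c] ≤ n) :
    ∃ d : Bool, f [c] < f [c, d] ∧ f [c, d] < f [c, !d] ∧ f [c, !d] < f [!c] ∧
      (2 * (f [c, !d] - f [c]) ≤ n → growth k ≤ n) := by
  have hroot := H.root
  have hpos : 0 < f [c] := H.pos (by simp) (by simp)
  have hchild (d : Bool) : f [c] < f [c, d] ∧ f [c, d] < f [!c] := by
    have h1 := H.between_iff (w := []) (x := [c]) (d := !c) (by simp) [d] (by simp)
      (by simp) (by simp)
    have h2 := H.arcLength_le [] c d (by simp)
    have h3 := H.ne (l := [c, d]) (l' := [c]) (by simp) (by simp) (by simp)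
    unfold arcLength at h2
    simp only [List.nil_append, List.cons_append, abs_eq_max_neg] at h1 h2
    omega
  obtain ⟨d, hd⟩ := H.exists_lt_not [c] (by simp)
  simp only [List.cons_append, List.nil_append] at hd
  refine ⟨d, (hchild d).1, hd, (hchild _).2, fun hn => ?_⟩
  obtain ⟨l, hl, hg⟩ := H.growth_mul_le k [c] d (by simp; omega) fun l hl => by
    have h1 := H.between_iff (w := [c]) (x := [c] ++ [d]) (d := !d) (by simp) l (by simp; omega)
      (by simp) (by simp)
    have := hchild d
    simp only [List.cons_append, List.nil_append] at h1 ⊢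
    omega
  have h1 := H.lt ([c] ++ [d] ++ l) (by simp; omega)
  have h2 := (hchild d).1
  simp only [List.cons_append, List.nil_append] at hg h1
  have : (0 : ℤ) ≤ growth k := by positivity
  nlinarith

/-- A layout of height `k + 2` needs a circle of at least `growth k` points. If `exists_grandchildren`
applied neither to the layout nor to its mirror image, then the two edges to the far grandchildren
would both exceed half of the circle, and so they would cross. -/
theorem growth_le {k : ℕ} (H : IsLayout n (k + 2) f) : growth k ≤ n := by
  obtain ⟨c, hc⟩ := H.exists_lt_not [] (by simp)
  simp only [List.nil_append] at hc
  by_contra hn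
  have hR (h2 : n ≤ 2 * f [!c]) : ∃ d : Bool, f [c] < f [!c, d] ∧ f [!c, d] < f [!c] ∧
      n < 2 * (f [!c] - f [!c, d]) := by
    obtain ⟨d, h3, h4, h5, h6⟩ := H.reflect.exists_grandchildren (c := !c)
      (by simpa using hc) (by simp; omega)
    simp only [Bool.not_not, reduceCtorEq, if_false] at h3 h4 h5 h6
    exact ⟨!d, by omega, by omega, by by_contra h7; exact hn (h6 (by omega))⟩
  by_cases h2 : 2 * f [c] ≤ n
  · obtain ⟨d, h3, h4, h5, h6⟩ := H.exists_grandchildren hc h2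
    have h7 : n < 2 * (f [c, !d] - f [c]) := by
      by_contra h7
      exact hn (h6 (by omega))
    have hpos : 0 < f [c] := H.pos (by simp) (by simp)
    obtain ⟨e, h8, h9, h10⟩ := hR (by omega)
    have hlt := H.lt [!c] (by simp)
    apply H.nonCrossing [c] (!d) [!c] e (by simp) (by simp)
    simp only [Crosses, List.cons_append, List.nil_append]
    omega
  · obtain ⟨e, h8, h9, h10⟩ := hR (by omega)
    have hlt := H.lt [!c] (by simp)
    omega

end IsLayout

/-! ### Points on a parabola -/

/-- The point of the parabola `y = x²` with abscissa `x`. -/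
noncomputable def parabolaPoint (x : ℝ) : Plane := !₂[x, x ^ 2]

@[simp] theorem parabolaPoint_zero (x : ℝ) : parabolaPoint x 0 = x := rfl

@[simp] theorem parabolaPoint_one (x : ℝ) : parabolaPoint x 1 = x ^ 2 := rfl

theorem not_collinear_parabolaPoint {x y z : ℝ} (hxy : x ≠ y) (hxz : x ≠ z) (hyz : y ≠ z) :
    ¬ Collinear ℝ {parabolaPoint x, parabolaPoint y, parabolaPoint z} := by
  intro h
  obtain ⟨p, v, hv⟩ := (collinear_iff_exists_forall_eq_smul_vadd (k := ℝ) _).1 h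
  obtain ⟨a, ha⟩ := hv (parabolaPoint x) (by simp)
  obtain ⟨b, hb⟩ := hv (parabolaPoint y) (by simp)
  obtain ⟨c, hc⟩ := hv (parabolaPoint z) (by simp)
  have a0 := congrArg (· 0) ha
  have a1 := congrArg (· 1) ha
  have b0 := congrArg (· 0) hb
  have b1 := congrArg (· 1) hb
  have c0 := congrArg (· 0) hc
  have c1 := congrArg (· 1) hc
  simp at a0 a1 b0 b1 c0 c1
  have : (y - x) * (z - x) * (z - y) = 0 := by
    have e : (y - x) * (z - x) * (z - y) = (y - x) * (z ^ 2 - x ^ 2) - (y ^ 2 - x ^ 2) * (z - x) := by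
      ring
    rw [e, a1, b1, c1, a0, b0, c0]
    ring
  simp only [mul_eq_zero, sub_eq_zero] at this
  tauto

theorem not_disjoint_openSegment_parabolaPoint {x y z w : ℝ} (hxy : x < y) (hyz : y < z)
    (hzw : z < w) :
    ¬ Disjoint (openSegment ℝ (parabolaPoint x) (parabolaPoint z))
      (openSegment ℝ (parabolaPoint y) (parabolaPoint w)) := by
  have hD : 0 < y + w - x - z := by linarith
  have hxz : 0 < z - x := by linarith
  have hyw : 0 < w - y := by linarith
  have h1 : 0 < y - x := by linarith
  have h2 : 0 < z - y := by linarith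
  have h3 : 0 < w - z := by linarith
  have h4 : 0 < w - x := by linarith
  -- the lines through the two pairs meet at the abscissa `(y * w - x * z) / (y + w - x - z)`
  rw [Set.not_disjoint_iff]
  refine ⟨((z - y) * (w - z) / ((z - x) * (y + w - x - z))) • parabolaPoint x +
      ((y - x) * (w - x) / ((z - x) * (y + w - x - z))) • parabolaPoint z,
    ⟨_, _, by positivity, by positivity, ?_, rfl⟩,
    ⟨(w - x) * (w - z) / ((w - y) * (y + w - x - z)),
      (y - x) * (z - y) / ((w - y) * (y + w - x - z)), by positivity, by positivity, ?_, ?_⟩⟩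
  · field_simp
    ring
  · field_simp
    ring
  · ext i
    fin_cases i
    · simp
      field_simp
      ring
    · simp
      field_simp
      ring

/-- The convex drawing with vertices `0, …, n - 1` at the points of the parabola with these
abscissas. -/
noncomputable def parabolaDrawing (n : ℕ) : StraightLineDrawing (Fin n) where
  point i := parabolaPoint (i : ℕ)
  injective i j hij := by
    have := congrArg (· 0) hij
    simpa [Fin.ext_iff] using this
  generalPosition u v w huv huw hvw := by
    apply not_collinear_parabolaPoint <;> simpa [← Fin.ext_iff]

theorem parabolaDrawing_point {n : ℕ} (i : Fin n) :
    (parabolaDrawing n).point i = parabolaPoint (i : ℕ) := rfl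

theorem parabolaDrawing_isConvex (n : ℕ) : (parabolaDrawing n).IsConvex := by
  intro s x hx
  by_contra hxs
  -- all other points are strictly above the tangent at `x`
  have hconv : Convex ℝ {p : Plane | 0 < p 1 - 2 * (x : ℕ) * p 0 + ((x : ℕ) : ℝ) ^ 2} := by
    intro p hp q hq a b ha hb hab
    simp only [Set.mem_ofPred_eq, PiLp.add_apply, PiLp.smul_apply, smul_eq_mul] at *
    have hb' : b = 1 - a := by linarith
    rcases ha.eq_or_lt with rfl | ha
    · simp_all
    · subst hb'
      nlinarith [mul_pos ha hp, mul_nonneg hb hq.le]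
  have hsub : (parabolaDrawing n).point '' s ⊆
      {p : Plane | 0 < p 1 - 2 * (x : ℕ) * p 0 + ((x : ℕ) : ℝ) ^ 2} := by
    rintro _ ⟨y, hy, rfl⟩
    have hne : ((y : ℕ) : ℝ) - (x : ℕ) ≠ 0 := by
      rw [sub_ne_zero]
      intro he
      apply hxs
      rwa [← Fin.ext (Nat.cast_injective he)]
    simp only [parabolaDrawing_point, Set.mem_ofPred_eq, parabolaPoint_zero, parabolaPoint_one]
    nlinarith [sq_pos_of_ne_zero hne]
  have := convexHull_min hsub hconv hx
  simp only [parabolaDrawing_point, Set.mem_ofPred_eq, parabolaPoint_zero, parabolaPoint_one] at this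
  nlinarith

theorem parabolaDrawing_orient {n : ℕ} (u v w : Fin n) :
    (parabolaDrawing n).orient u v w =
      ((v : ℕ) - (u : ℕ) : ℝ) * ((w : ℕ) - (u : ℕ)) * ((w : ℕ) - (v : ℕ)) := by
  simp only [StraightLineDrawing.orient, parabolaDrawing_point, parabolaPoint_zero,
    parabolaPoint_one]
  ring

theorem StraightLineDrawing.orient_swap {V : Type} (D : StraightLineDrawing V) (u v w : V) :
    D.orient v u w = -D.orient u v w := by
  simp only [StraightLineDrawing.orient]
  ring

theorem StraightLineDrawing.smallerSide_comm {V : Type} (D : StraightLineDrawing V) (u v : V) :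
    D.smallerSide u v = D.smallerSide v u := by
  simp only [StraightLineDrawing.smallerSide, D.orient_swap u v, Left.neg_pos_iff,
    Left.neg_neg_iff]
  exact min_comm _ _

theorem parabolaDrawing_smallerSide_of_lt {n : ℕ} {u v : Fin n} (huv : u < v) :
    ((parabolaDrawing n).smallerSide u v : ℤ) + 1 = arcLength n (u : ℕ) (v : ℕ) := by
  have huv' : ((u : ℕ) : ℝ) < (v : ℕ) := by exact_mod_cast huv
  have hneg : {w | (parabolaDrawing n).orient u v w < 0} = ↑(Finset.Ioo u v) := by
    ext w
    simp only [parabolaDrawing_orient, Set.mem_ofPred_eq, Finset.coe_Ioo, Set.mem_Ioo]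
    rw [mul_assoc, mul_neg_iff, mul_neg_iff]
    simp only [sub_pos, sub_neg, Nat.cast_lt, Fin.val_fin_lt]
    constructor
    · rintro (⟨_, h | h⟩ | h) <;> grind
    · grind
  have hpos : {w | 0 < (parabolaDrawing n).orient u v w} =
      ↑(Finset.Iio u ∪ Finset.Ioi v) := by
    ext w
    simp only [parabolaDrawing_orient, Set.mem_ofPred_eq, Finset.coe_union, Finset.coe_Iio,
      Finset.coe_Ioi, Set.mem_union, Set.mem_Iio, Set.mem_Ioi]
    rw [mul_assoc, mul_pos_iff, mul_pos_iff]
    simp only [sub_pos, sub_neg, Nat.cast_lt, Fin.val_fin_lt]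
    constructor
    · rintro (⟨_, h | h⟩ | h) <;> grind
    · grind
  have hdisj : Disjoint (Finset.Iio u) (Finset.Ioi v) := by
    rw [Finset.disjoint_left]
    intro w h1 h2
    simp only [Finset.mem_Iio, Finset.mem_Ioi] at h1 h2
    exact absurd (h1.trans huv) h2.asymm
  rw [StraightLineDrawing.smallerSide, hneg, hpos, Set.ncard_coe_finset, Set.ncard_coe_finset,
    Finset.card_union_of_disjoint hdisj, Fin.card_Iio, Fin.card_Ioi, Fin.card_Ioo, arcLength,
    abs_eq_max_neg]
  have := v.isLt
  have : (u : ℕ) < v := huv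
  omega

/-- The cyclic length of an edge exceeds the number of vertices on its smaller side by one. Ordering
the edges by their smaller sides is thus ordering them by cyclic length. -/
theorem parabolaDrawing_smallerSide {n : ℕ} {u v : Fin n} (huv : u ≠ v) :
    ((parabolaDrawing n).smallerSide u v : ℤ) + 1 = arcLength n (u : ℕ) (v : ℕ) := by
  rcases lt_or_gt_of_ne huv with h | h
  · exact parabolaDrawing_smallerSide_of_lt h
  · rw [StraightLineDrawing.smallerSide_comm, parabolaDrawing_smallerSide_of_lt h, arcLength,
      arcLength, abs_sub_comm]

theorem not_disjoint_of_crosses {n : ℕ} {a b c d : Fin n}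
    (hcr : Crosses (a : ℕ) (b : ℕ) (c : ℕ) (d : ℕ)) :
    ¬ Disjoint (openSegment ℝ ((parabolaDrawing n).point a) ((parabolaDrawing n).point b))
      (openSegment ℝ ((parabolaDrawing n).point c) ((parabolaDrawing n).point d)) := by
  wlog hab : a ≤ b generalizing a b
  · rw [openSegment_symm]
    exact this (by simpa only [Crosses, min_comm, max_comm] using hcr) (le_of_not_ge hab)
  wlog hcd : c ≤ d generalizing c d
  · rw [openSegment_symm ℝ ((parabolaDrawing n).point c)]
    exact this (by simpa only [Crosses, min_comm, max_comm] using hcr) (le_of_not_ge hcd)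
  have hab' : (a : ℕ) ≤ b := hab
  have hcd' : (c : ℕ) ≤ d := hcd
  unfold Crosses at hcr
  simp only [parabolaDrawing_point]
  apply not_disjoint_openSegment_parabolaPoint <;> rw [Nat.cast_lt] <;> omega

/-! ### From non-crossing trees to layouts -/

/-- The position of `v` on the circle `0, …, n - 1` cut open at `r`. -/
def rotate {n : ℕ} (r v : Fin n) : ℤ :=
  if r ≤ v then (v : ℕ) - (r : ℕ) else (v : ℕ) - (r : ℕ) + n

theorem rotate_cases {n : ℕ} (r v : Fin n) :
    ((r : ℕ) ≤ v ∧ rotate r v = (v : ℕ) - (r : ℕ)) ∨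
      ((v : ℕ) < r ∧ rotate r v = (v : ℕ) - (r : ℕ) + n) := by
  unfold rotate
  split_ifs with h
  · exact Or.inl ⟨h, rfl⟩
  · exact Or.inr ⟨not_le.1 h, rfl⟩

theorem arcLength_rotate {n : ℕ} (r u v : Fin n) :
    arcLength n (rotate r u) (rotate r v) = arcLength n (u : ℕ) (v : ℕ) := by
  have h1 := rotate_cases r u
  have h2 := rotate_cases r v
  have := u.isLt
  have := v.isLt
  have := r.isLt
  simp only [arcLength, abs_eq_max_neg]
  omega

/-- Rotating the circle keeps alternating pairs alternating, but may change the pair which contains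
the leftmost point. -/
theorem crosses_of_crosses_rotate {n : ℕ} {r a b c d : Fin n}
    (hcr : Crosses (rotate r a) (rotate r b) (rotate r c) (rotate r d)) :
    Crosses (a : ℕ) (b : ℕ) (c : ℕ) (d : ℕ) ∨ Crosses (c : ℕ) (d : ℕ) (a : ℕ) (b : ℕ) := by
  wlog hab : rotate r a ≤ rotate r b generalizing a b
  · simpa only [Crosses, min_comm, max_comm] using
      this (by simpa only [Crosses, min_comm, max_comm] using hcr) (le_of_not_ge hab)
  wlog hcd : rotate r c ≤ rotate r d generalizing c d
  · simpa only [Crosses, min_comm, max_comm] using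
      this (by simpa only [Crosses, min_comm, max_comm] using hcr) (le_of_not_ge hcd)
  rw [Crosses, min_eq_left hab, min_eq_left hcd, max_eq_right hab, max_eq_right hcd] at hcr
  obtain ⟨hac, hcb, hbd⟩ := hcr
  have h1 := rotate_cases r a
  have h2 := rotate_cases r b
  have h3 := rotate_cases r c
  have h4 := rotate_cases r d
  have := a.isLt
  have := b.isLt
  have := c.isLt
  have := d.isLt
  unfold Crosses
  obtain h | h | h | h : ((a : ℕ) < c ∧ (c : ℕ) < b ∧ (b : ℕ) < d) ∨
      ((d : ℕ) < a ∧ (a : ℕ) < c ∧ (c : ℕ) < b) ∨ ((b : ℕ) < d ∧ (d : ℕ) < a ∧ (a : ℕ) < c) ∨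
      ((c : ℕ) < b ∧ (b : ℕ) < d ∧ (d : ℕ) < a) := by omega
  all_goals
    clear h1 h2 h3 h4 hac hcb hbd hab hcd
    omega

namespace EmbeddedBinaryTree

variable {n h : ℕ}

theorem isLayout (T : EmbeddedBinaryTree (⊤ : SimpleGraph (Fin n)) h)
    (hT : (parabolaDrawing n).NonCrossing T.edges)
    (hlen : ∀ l b c, l.length + 1 < h →
      (parabolaDrawing n).smallerSide (T.node l) (T.node (l ++ [b])) ≤
        (parabolaDrawing n).smallerSide (T.node (l ++ [b])) (T.node (l ++ [b] ++ [c]))) :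
    IsLayout n h fun l => rotate (T.node []) (T.node l) where
  injOn := by
    intro l hl l' hl' he
    apply T.injOn hl hl'
    have h1 := rotate_cases (T.node []) (T.node l)
    have h2 := rotate_cases (T.node []) (T.node l')
    have := (T.node l).isLt
    have := (T.node l').isLt
    dsimp only at he
    apply Fin.ext
    omega
  root := by simp [rotate]
  nonneg l _ := by
    have h1 := rotate_cases (T.node []) (T.node l)
    have := (T.node []).isLt
    omega
  lt l _ := by
    have h1 := rotate_cases (T.node []) (T.node l)
    have := (T.node l).isLt
    omega
  nonCrossing := by
    intro l b l' b' hl hl' hcr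
    have hdisj := hT (T.node l) (T.node (l ++ [b])) (T.node l') (T.node (l' ++ [b']))
      ⟨l, b, hl, rfl⟩ ⟨l', b', hl', rfl⟩ fun he => by
        rcases Sym2.eq_iff.1 he with ⟨h1, h2⟩ | ⟨h1, h2⟩
        · simp [Crosses, h1, h2] at hcr
        · simp [Crosses, h1, h2, min_comm] at hcr
    rcases crosses_of_crosses_rotate hcr with hc | hc
    · exact not_disjoint_of_crosses hc hdisj
    · exact not_disjoint_of_crosses hc hdisj.symm
  arcLength_le := by
    intro l b c hl
    have h1 := hlen l b c hl
    rw [arcLength_rotate, arcLength_rotate,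
      ← parabolaDrawing_smallerSide (T.adj l b (by omega)).ne,
      ← parabolaDrawing_smallerSide (T.adj (l ++ [b]) c (by simpa using hl)).ne]
    omega

theorem ncard_length_le (h : ℕ) :
    {l : List Bool | l.length ≤ h}.Finite ∧ {l : List Bool | l.length ≤ h}.ncard < 2 ^ (h + 1) := by
  induction h with
  | zero =>
    have : {l : List Bool | l.length ≤ 0} = {[]} := by ext; simp
    rw [this]
    simp
  | succ h ih =>
    obtain ⟨hfin, hcard⟩ := ih
    have : {l : List Bool | l.length ≤ h + 1} = insert []
        (List.cons false '' {l | l.length ≤ h} ∪ List.cons true '' {l | l.length ≤ h}) := by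
      ext l
      rcases l with _ | ⟨_ | _, l⟩ <;> simp
    rw [this]
    refine ⟨((hfin.image _).union (hfin.image _)).insert _, ?_⟩
    have h1 := Set.ncard_insert_le []
      (List.cons false '' {l | l.length ≤ h} ∪ List.cons true '' {l | l.length ≤ h})
    have h2 := Set.ncard_union_le
      (List.cons false '' {l | l.length ≤ h}) (List.cons true '' {l | l.length ≤ h})
    have h3 := Set.ncard_image_le (f := List.cons false) hfin
    have h4 := Set.ncard_image_le (f := List.cons true) hfin
    rw [pow_succ]
    omega

theorem size_lt {V : Type} {G : SimpleGraph V} (T : EmbeddedBinaryTree G h) :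
    T.size < 2 ^ (h + 1) :=
  (Set.ncard_image_le (ncard_length_le h).1).trans_lt (ncard_length_le h).2

theorem size_le (hn : 2 ≤ n) (T : EmbeddedBinaryTree (⊤ : SimpleGraph (Fin n)) h)
    (hT : (parabolaDrawing n).NonCrossing T.edges)
    (hlen : ∀ l b c, l.length + 1 < h →
      (parabolaDrawing n).smallerSide (T.node l) (T.node (l ++ [b])) ≤
        (parabolaDrawing n).smallerSide (T.node (l ++ [b])) (T.node (l ++ [b] ++ [c]))) :
    (T.size : ℝ) ≤ 16 / Real.log 2 * Real.log n := by
  have hlog : 0 < Real.log 2 := Real.log_pos (by norm_num)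
  have hsize : (T.size : ℝ) ≤ 2 ^ (h + 1) := by exact_mod_cast T.size_lt.le
  rw [div_mul_eq_mul_div, le_div_iff₀ hlog]
  rcases Nat.lt_or_ge h 3 with hh | hh
  · have h1 : Real.log 2 ≤ Real.log n := Real.log_le_log (by norm_num) (by exact_mod_cast hn)
    have h2 : (2 : ℝ) ^ (h + 1) ≤ 2 ^ 3 := pow_le_pow_right₀ (by norm_num) (by omega)
    nlinarith
  · obtain ⟨k, rfl⟩ := Nat.exists_eq_add_of_le' hh
    have h1 : growth (k + 1) ≤ n := by
      exact_mod_cast (T.isLayout hT hlen).growth_le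
    have h2 : (2 : ℝ) ^ 2 ^ k ≤ n := by
      exact_mod_cast (two_pow_two_pow_le_growth k).trans h1
    have h3 := Real.log_le_log (by positivity) h2
    rw [Real.log_pow] at h3
    push_cast at h3
    have h4 : (2 : ℝ) ^ (k + 3 + 1) = 16 * 2 ^ k := by ring
    rw [h4] at hsize
    nlinarith

/-- Every word of length at most `h - 2` and two further letters extend to a leaf. -/
theorem exists_leaf (l : List Bool) (b c : Bool) (hl : l.length + 1 < h) :
    ∃ m : List Bool, m.length = h ∧ m.take l.length = l ∧ m.take (l.length + 1) = l ++ [b] ∧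
      m.take (l.length + 2) = l ++ [b] ++ [c] := by
  refine ⟨l ++ [b] ++ [c] ++ List.replicate (h - l.length - 2) false, ?_, ?_, ?_, ?_⟩
  · simp
    omega
  all_goals simp [List.take_append]

theorem Increasing.less {V : Type} {G : SimpleGraph V} {T : EmbeddedBinaryTree G h}
    {o : EdgeOrdering G} (hT : T.Increasing o) (l : List Bool) (b c : Bool)
    (hl : l.length + 1 < h) :
    EdgeOrdering.Less o s(T.node l, T.node (l ++ [b]))
      s(T.node (l ++ [b]), T.node (l ++ [b] ++ [c])) := by
  obtain ⟨m, hm, h0, h1, h2⟩ := exists_leaf l b c hl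
  have := hT m hm l.length (by omega)
  simpa only [h0, h1, h2] using this

theorem Decreasing.less {V : Type} {G : SimpleGraph V} {T : EmbeddedBinaryTree G h}
    {o : EdgeOrdering G} (hT : T.Decreasing o) (l : List Bool) (b c : Bool)
    (hl : l.length + 1 < h) :
    EdgeOrdering.Less o s(T.node (l ++ [b]), T.node (l ++ [b] ++ [c]))
      s(T.node l, T.node (l ++ [b])) := by
  obtain ⟨m, hm, h0, h1, h2⟩ := exists_leaf l b c hl
  have := hT m hm l.length (by omega)
  simpa only [h0, h1, h2] using this

end EmbeddedBinaryTree

/-! ### Edge-orderings by the smaller side -/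

theorem EdgeOrdering.Less.asymm {V : Type} {G : SimpleGraph V} {o : EdgeOrdering G}
    {e f : Sym2 V} (h₁ : EdgeOrdering.Less o e f) (h₂ : EdgeOrdering.Less o f e) : False := by
  obtain ⟨_, _, h₁⟩ := h₁
  obtain ⟨_, _, h₂⟩ := h₂
  exact @lt_asymm _ o.toPreorder _ _ h₁ h₂

theorem exists_linearOrder_lt_of_lt {α β : Type} [Finite α] [LinearOrder β] (s : α → β) :
    ∃ o : LinearOrder α, ∀ a b, s a < s b → o.lt a b := by
  obtain ⟨N, ⟨e⟩⟩ := Finite.exists_equiv_fin α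
  refine ⟨LinearOrder.lift' (fun a => toLex (s a, e a)) fun a b hab => ?_, fun a b hab => ?_⟩
  · exact e.injective (congrArg (fun p => (ofLex p).2) hab)
  · exact Prod.Lex.toLex_lt_toLex.2 (Or.inl hab)

namespace StraightLineDrawing

variable {V : Type}

/-- The number of vertices on the smaller side of an unordered pair. -/
noncomputable def edgeSmallerSide (D : StraightLineDrawing V) : Sym2 V → ℕ :=
  Sym2.lift ⟨D.smallerSide, D.smallerSide_comm⟩

theorem exists_edgeOrdering_increasing [Finite V] (D : StraightLineDrawing V) :
    ∃ o : EdgeOrdering (⊤ : SimpleGraph V), ∀ u v u' v' : V, u ≠ v → u' ≠ v' →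
      D.smallerSide u v < D.smallerSide u' v' → EdgeOrdering.Less o s(u, v) s(u', v') := by
  obtain ⟨o, ho⟩ := exists_linearOrder_lt_of_lt
    fun e : (⊤ : SimpleGraph V).edgeSet => D.edgeSmallerSide e
  exact ⟨o, fun u v u' v' h h' hlt => ⟨by simpa using h, by simpa using h', ho _ _ hlt⟩⟩

theorem exists_edgeOrdering_decreasing [Finite V] (D : StraightLineDrawing V) :
    ∃ o : EdgeOrdering (⊤ : SimpleGraph V), ∀ u v u' v' : V, u ≠ v → u' ≠ v' →
      D.smallerSide u v < D.smallerSide u' v' → EdgeOrdering.Less o s(u', v') s(u, v) := by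
  obtain ⟨o, ho⟩ := exists_linearOrder_lt_of_lt
    fun e : (⊤ : SimpleGraph V).edgeSet => OrderDual.toDual (D.edgeSmallerSide e)
  exact ⟨o, fun u v u' v' h h' hlt => ⟨by simpa using h', by simpa using h,
    ho _ _ (OrderDual.toDual_lt_toDual.2 hlt)⟩⟩

end StraightLineDrawing

theorem exists_convex_drawing_size_le (n : ℕ) (hn : 2 ≤ n) :
    ∃ D : StraightLineDrawing (Fin n), D.IsConvex ∧
      (∃ o : EdgeOrdering (⊤ : SimpleGraph (Fin n)),
        (∀ u v u' v' : Fin n, u ≠ v → u' ≠ v' →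
          D.smallerSide u v < D.smallerSide u' v' →
          EdgeOrdering.Less o s(u, v) s(u', v')) ∧
        ∀ (h : ℕ) (T : EmbeddedBinaryTree (⊤ : SimpleGraph (Fin n)) h),
          D.NonCrossing T.edges → T.Increasing o →
            (T.size : ℝ) ≤ 16 / Real.log 2 * Real.log n) ∧
      (∃ o : EdgeOrdering (⊤ : SimpleGraph (Fin n)),
        (∀ u v u' v' : Fin n, u ≠ v → u' ≠ v' →
          D.smallerSide u v < D.smallerSide u' v' →
          EdgeOrdering.Less o s(u', v') s(u, v)) ∧
        ∀ (h : ℕ) (T : EmbeddedBinaryTree (⊤ : SimpleGraph (Fin n)) h),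
          D.NonCrossing T.edges → T.Decreasing o →
            (T.size : ℝ) ≤ 16 / Real.log 2 * Real.log n) := by
  refine ⟨parabolaDrawing n, parabolaDrawing_isConvex n, ?_, ?_⟩
  · obtain ⟨o, ho⟩ := (parabolaDrawing n).exists_edgeOrdering_increasing
    refine ⟨o, ho, fun h T hnc hT => T.size_le hn hnc fun l b c hl => ?_⟩
    by_contra! hlt
    exact (hT.less l b c hl).asymm (ho _ _ _ _ (T.adj (l ++ [b]) c (by simpa using hl)).ne
      (T.adj l b (by omega)).ne hlt)
  · obtain ⟨o, ho⟩ := (parabolaDrawing n).exists_edgeOrdering_decreasing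
    refine ⟨o, ho, fun h T hnc hT => T.size_le hn hnc fun l b c hl => ?_⟩
    by_contra! hlt
    exact (hT.less l b c hl).asymm (ho _ _ _ _ (T.adj (l ++ [b]) c (by simpa using hl)).ne
      (T.adj l b (by omega)).ne hlt)

/-! ### The parameters of complete graphs -/

theorem sSup_le_of_forall_le_real {s : Set ℕ} {B : ℝ} (hB : 0 ≤ B) (h : ∀ m ∈ s, (m : ℝ) ≤ B) :
    ((sSup s : ℕ) : ℝ) ≤ B := by
  rcases s.eq_empty_or_nonempty with rfl | hs
  · simpa using hB
  · exact (Nat.le_floor_iff hB).1 (csSup_le hs fun m hm => Nat.le_floor (h m hm))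

theorem tauPlus_le {V : Type} {G : SimpleGraph V} (D : StraightLineDrawing V)
    (o : EdgeOrdering G) : tauPlus G ≤ maxIncreasing G D o :=
  (ciInf_le (OrderBot.bddBelow _) D).trans (ciInf_le (OrderBot.bddBelow _) o)

theorem tauMinus_le {V : Type} {G : SimpleGraph V} (D : StraightLineDrawing V)
    (o : EdgeOrdering G) : tauMinus G ≤ maxDecreasing G D o :=
  (ciInf_le (OrderBot.bddBelow _) D).trans (ciInf_le (OrderBot.bddBelow _) o)

theorem isBigO_log_of_le {t : ℕ → ℕ} {C : ℝ} (h : ∀ n, 2 ≤ n → (t n : ℝ) ≤ C * Real.log n) :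
    (fun n : ℕ => (t n : ℝ)) =O[atTop] fun n : ℕ => Real.log n := by
  refine IsBigO.of_bound C ?_
  filter_upwards [eventually_ge_atTop 2] with n hn
  rw [Real.norm_of_nonneg (Nat.cast_nonneg _), Real.norm_of_nonneg (Real.log_natCast_nonneg n)]
  exact h n hn

theorem theorem5 :
    (∃ C : ℝ, 0 < C ∧ ∀ n : ℕ, 2 ≤ n →
      ∃ D : StraightLineDrawing (Fin n), D.IsConvex ∧
        (∃ o : EdgeOrdering (⊤ : SimpleGraph (Fin n)),
          (∀ u v u' v' : Fin n, u ≠ v → u' ≠ v' →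
            D.smallerSide u v < D.smallerSide u' v' →
            EdgeOrdering.Less o s(u, v) s(u', v')) ∧
          ∀ (h : ℕ) (T : EmbeddedBinaryTree (⊤ : SimpleGraph (Fin n)) h),
            D.NonCrossing T.edges → T.Increasing o → (T.size : ℝ) ≤ C * Real.log n) ∧
        (∃ o : EdgeOrdering (⊤ : SimpleGraph (Fin n)),
          (∀ u v u' v' : Fin n, u ≠ v → u' ≠ v' →
            D.smallerSide u v < D.smallerSide u' v' →
            EdgeOrdering.Less o s(u', v') s(u, v)) ∧
          ∀ (h : ℕ) (T : EmbeddedBinaryTree (⊤ : SimpleGraph (Fin n)) h),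
            D.NonCrossing T.edges → T.Decreasing o → (T.size : ℝ) ≤ C * Real.log n)) ∧
    ((fun n : ℕ => (tauPlus (⊤ : SimpleGraph (Fin n)) : ℝ)) =O[atTop]
      fun n : ℕ => Real.log n) ∧
    ((fun n : ℕ => (tauMinus (⊤ : SimpleGraph (Fin n)) : ℝ)) =O[atTop]
      fun n : ℕ => Real.log n) := by
  have hC : 0 < 16 / Real.log 2 := div_pos (by norm_num) (Real.log_pos (by norm_num))
  refine ⟨⟨16 / Real.log 2, hC, exists_convex_drawing_size_le⟩,
    isBigO_log_of_le (C := 16 / Real.log 2) fun n hn => ?_,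
    isBigO_log_of_le (C := 16 / Real.log 2) fun n hn => ?_⟩
  · obtain ⟨D, -, ⟨o, -, ho⟩, -⟩ := exists_convex_drawing_size_le n hn
    refine (Nat.cast_le.2 (tauPlus_le D o)).trans
      (sSup_le_of_forall_le_real (mul_nonneg hC.le (Real.log_natCast_nonneg n)) ?_)
    rintro _ ⟨h, T, hnc, hT, rfl⟩
    exact ho h T hnc hT
  · obtain ⟨D, -, -, ⟨o, -, ho⟩⟩ := exists_convex_drawing_size_le n hn
    refine (Nat.cast_le.2 (tauMinus_le D o)).trans
      (sSup_le_of_forall_le_real (mul_nonneg hC.le (Real.log_natCast_nonneg n)) ?_)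
    rintro _ ⟨h, T, hnc, hT, rfl⟩
    exact ho h T hnc hT
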